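/- Let $n\ge 0$ and let $O=\sum_{ij}o_{ij}|i\rangle\langle j|\in\mathbb{C}^{2^n\times 2^n}$ be an arbitrary (not necessarily Hermitian) $n$-qubit operator with Frobenius norm $\|O\|_F=1$, where $i,j$ run over bit strings of length $n$. Let $|O\rangle=\sum_{ij}o_{ij}|i\rangle|j\rangle$ be its vectorization. For a finite probability distribution $p=\{p_i\}$ let $H_\alpha(p)=\frac{1}{1-\alpha}\log_2\sum_i p_i^\alpha$ be the Rényi entropy of order $\alpha$, with the limiting expressions $H_1(p)=-\sum_i p_i\log_2 p_i$ and $H_\infty(p)=-\log_2\max_i p_i$. Define: * $H_{CBC,\alpha}(|O\rangle)=H_\alpha(\{|o_{ij}|^2\})$ (computational basis coherence); * $H_{BBC,\alpha}(|O\rangle)=H_\alpha(\{|b_k|^2\})$ (Bell basis coherence), where $|O\rangle=\sum_k b_k|B_k\rangle$ and the Bell basis vectors $|B_k\rangle$ are the vectorizations of $2^{-n/2}P_k$, with $P_k$ running over the $4^n$ Pauli strings in $\{I,X,Y,Z\}^{\otimes n}$; * $H_{TE,\alpha}(|O\rangle)=H_\alpha(\{\gamma_x^2\})$ (time entanglement),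 where $|O\rangle=\sum_{x\in\{0,1\}^n}\gamma_x|r_x\rangle\otimes|c_x\rangle$, with $\gamma_x\ge 0$ and $\{|r_x\rangle\}$, $\{|c_x\rangle\}$ orthonormal, is a Schmidt decomposition between the row qubits (first tensor factor) and the column qubits (second tensor factor), i.e. the $\gamma_x$ are the $2^n$ singular values of $O$ (zeros included); * $H_{FTE,\alpha}(|O\rangle)=H_\alpha(\{\lambda_s^2\})$ (Fourier time entanglement), where $\lambda_s=\bigl|2^{-n/2}\sum_{x}(-1)^{s\cdot x}\gamma_x\bigr|$ for $s\in\{0,1\}^n$; equivalently $\lambda_s\ge 0$ and $\sum_x\gamma_x|x\rangle\langle x|=2^{-n/2}\sum_s\lambda_sQ_s$ with $Q_s=\pm Z^{s}$, $Z^{s}=Z^{s_1}\otimes\cdots\otimes Z^{s_n}$. Then for all $\alpha,\beta\in[1/2,\infty]$ with $1/\alpha+1/\beta=2$ (where $1/\infty=0$), $$H_{CBC,\alpha}(|O\rangle)+H_{BBC,\beta}(|O\rangle)\ge n,$$ and, for every Schmidt decomposition as above (that is, for every labelling of the singular values by bit strings), $$H_{TE,\alpha}(|O\rangle)+H_{FTE,\beta}(|O\rangle)\ge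 n.$$ -/

import Mathlib

open scoped ENNReal

attribute [local instance] Matrix.frobeniusNormedAddCommGroup

namespace OperatorEntropy

/-- Labels of the computational basis of `n` qubits: bit strings of length `n`. -/
abbrev Bits (n : ℕ) : Type := Fin n → Fin 2

/-- Linear operators on `n` qubits, as matrices in the computational basis. -/
abbrev QubitOp (n : ℕ) : Type := Matrix (Bits n) (Bits n) ℂ

/-- The Rényi entropy (base-2 logarithm) of order `α ∈ [0, ∞]` of a distribution on a finite set.
Orders `1` (Shannon entropy) and `∞` (min-entropy) are the usual limiting expressions. -/
noncomputable def renyiEntropy {ι : Type} [Fintype ι] (α : ℝ≥0∞) (p : ι → ℝ) : ℝ :=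
  if α = 1 then -∑ i, p i * Real.logb 2 (p i)
  else if α = ∞ then -Real.logb 2 (⨆ i, p i)
  else 1 / (1 - α.toReal) * Real.logb 2 (∑ i, p i ^ α.toReal)

/-- Vectorization `O = ∑ o_ij |i⟩⟨j| ↦ |O⟩ = ∑ o_ij |i⟩|j⟩`, a vector of `2n` qubits. -/
noncomputable def vectorize {n : ℕ} (O : QubitOp n) : EuclideanSpace ℂ (Bits n × Bits n) :=
  WithLp.toLp 2 fun x => O x.1 x.2

/-- The single-qubit Pauli matrices `I, X, Y, Z`, in this order. -/
noncomputable def pauli : Fin 4 → Matrix (Fin 2) (Fin 2) ℂ :=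
  ![!![1, 0; 0, 1], !![0, 1; 1, 0], !![0, -Complex.I; Complex.I, 0], !![1, 0; 0, -1]]

/-- The `n`-qubit Pauli operator `pauli (k 0) ⊗ ⋯ ⊗ pauli (k (n - 1))`. -/
noncomputable def pauliString {n : ℕ} (k : Fin n → Fin 4) : QubitOp n :=
  Matrix.of fun x y => ∏ i, pauli (k i) (x i) (y i)

/-- The scalar `2 ^ (-n / 2)`. -/
noncomputable def normFactor (n : ℕ) : ℝ := (√(2 ^ n : ℝ))⁻¹

/-- The Bell basis vector `|B_k⟩`: the vectorization of the normalized Pauli operator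
`2 ^ (-n / 2) P_k`. -/
noncomputable def bellVec {n : ℕ} (k : Fin n → Fin 4) : EuclideanSpace ℂ (Bits n × Bits n) :=
  vectorize ((normFactor n : ℂ) • pauliString k)

/-- The coefficient `b_k = ⟨B_k|ψ⟩` of `|B_k⟩` in the Bell basis decomposition
(see `sum_bellCoeff_smul_bellVec`). -/
noncomputable def bellCoeff {n : ℕ} (ψ : EuclideanSpace ℂ (Bits n × Bits n))
    (k : Fin n → Fin 4) : ℂ :=
  inner ℂ (bellVec k) ψ

/-- The Rényi entropy of the squared amplitudes in the computational basis. -/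
noncomputable def cbcEntropy {n : ℕ} (α : ℝ≥0∞) (ψ : EuclideanSpace ℂ (Bits n × Bits n)) : ℝ :=
  renyiEntropy α fun x : Bits n × Bits n => ‖ψ x‖ ^ 2

/-- The Rényi entropy of the squared amplitudes in the Bell basis. -/
noncomputable def bbcEntropy {n : ℕ} (α : ℝ≥0∞) (ψ : EuclideanSpace ℂ (Bits n × Bits n)) : ℝ :=
  renyiEntropy α fun k : Fin n → Fin 4 => ‖bellCoeff ψ k‖ ^ 2

/-- `γ` lists, with some labelling by bit strings, all `2 ^ n` Schmidt coefficients (zeros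
included) of `ψ` across the time bipartition, which separates the row qubits (first factor) from
the column qubits (second factor): `ψ = ∑ γ_k |r_k⟩ ⊗ |c_k⟩` with `γ_k ≥ 0` and `r`, `c`
orthonormal. -/
def IsTimeSchmidt {n : ℕ} (ψ : EuclideanSpace ℂ (Bits n × Bits n)) (γ : Bits n → ℝ) : Prop :=
  (∀ k, 0 ≤ γ k) ∧
  ∃ r c : Bits n → EuclideanSpace ℂ (Bits n), Orthonormal ℂ r ∧ Orthonormal ℂ c ∧
    ∀ i j, ψ (i, j) = ∑ k, (γ k : ℂ) * (r k i * c k j)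

/-- The Pauli operator in `{I, Z}^{⊗ n}` with `Z` exactly at the positions where `s` is `1`. -/
noncomputable def zString {n : ℕ} (s : Bits n) : QubitOp n :=
  pauliString fun i => if s i = 0 then 0 else 3

/-- The Walsh–Hadamard coefficients `λ_s = |2 ^ (-n / 2) ∑_x (-1) ^ (s ⬝ x) γ_x|`, i.e. the
non-negative numbers such that `∑ γ_x |x⟩⟨x| = 2 ^ (-n / 2) ∑_s λ_s Q_s` with `Q_s = ± zString s`
(see `diagonal_eq_sum_walshCoeff`). -/
noncomputable def walshCoeff {n : ℕ} (γ : Bits n → ℝ) (s : Bits n) : ℝ :=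
  |normFactor n * ∑ x, (-1) ^ (∑ i, (s i : ℕ) * (x i : ℕ)) * γ x|

/-- The time-entanglement Rényi entropy, from the Schmidt coefficients `γ`. -/
noncomputable def teEntropy {n : ℕ} (α : ℝ≥0∞) (γ : Bits n → ℝ) : ℝ :=
  renyiEntropy α fun x => γ x ^ 2

/-- The Fourier time-entanglement Rényi entropy, from the Schmidt coefficients `γ`. -/
noncomputable def fteEntropy {n : ℕ} (α : ℝ≥0∞) (γ : Bits n → ℝ) : ℝ :=
  renyiEntropy α fun s => walshCoeff γ s ^ 2

theorem normFactor_mul_self (n : ℕ) : (normFactor n : ℂ) * normFactor n = ((2 : ℂ) ^ n)⁻¹ := by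
  have h : normFactor n * normFactor n = ((2 : ℝ) ^ n)⁻¹ := by
    rw [normFactor, ← mul_inv, Real.mul_self_sqrt (by positivity)]
  rw [← Complex.ofReal_mul, h]
  push_cast
  rfl

theorem pauli_complete (a b c d : Fin 2) :
    ∑ k, (starRingEnd ℂ) (pauli k a b) * pauli k c d = if (a, b) = (c, d) then 2 else 0 := by
  fin_cases a <;> fin_cases b <;> fin_cases c <;> fin_cases d <;>
    simp [pauli, Fin.sum_univ_four] <;> norm_num

theorem pauliString_complete {n : ℕ} (a b c d : Bits n) :
    ∑ k, (starRingEnd ℂ) (pauliString k a b) * pauliString k c d =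
      if (a, b) = (c, d) then 2 ^ n else 0 := by
  simp only [pauliString, Matrix.of_apply, map_prod, ← Finset.prod_mul_distrib]
  rw [← Fintype.piFinset_univ, ← Finset.prod_univ_sum (fun _ => Finset.univ)
    (fun i k => (starRingEnd ℂ) (pauli k (a i) (b i)) * pauli k (c i) (d i))]
  simp only [pauli_complete]
  split_ifs with h
  · obtain ⟨rfl, rfl⟩ := Prod.mk.inj h
    simp
  · have : ∃ i, ¬ (a i, b i) = (c i, d i) := by
      by_contra! hh
      exact h (Prod.ext (funext fun i => (Prod.mk.inj (hh i)).1)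
        (funext fun i => (Prod.mk.inj (hh i)).2))
    obtain ⟨i, hi⟩ := this
    exact Finset.prod_eq_zero (Finset.mem_univ i) (if_neg hi)

/-- The numbers `bellCoeff ψ k` are the coefficients of `ψ` in the Bell basis. -/
theorem sum_bellCoeff_smul_bellVec {n : ℕ} (ψ : EuclideanSpace ℂ (Bits n × Bits n)) :
    ∑ k, bellCoeff ψ k • bellVec k = ψ := by
  ext ⟨c, d⟩
  have key : ∀ x : Bits n × Bits n, ∑ k : Fin n → Fin 4,
      (ψ x * (starRingEnd ℂ) (normFactor n * pauliString k x.1 x.2)) *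
        (normFactor n * pauliString k c d) = if x = (c, d) then ψ x else 0 := by
    rintro ⟨a, b⟩
    have h : ∀ k : Fin n → Fin 4,
        (ψ (a, b) * (starRingEnd ℂ) (normFactor n * pauliString k a b)) *
        (normFactor n * pauliString k c d) = (ψ (a, b) * (normFactor n * normFactor n)) *
          ((starRingEnd ℂ) (pauliString k a b) * pauliString k c d) := by
      intro k
      rw [map_mul, Complex.conj_ofReal]
      ring
    simp only [h]
    rw [← Finset.mul_sum, pauliString_complete, normFactor_mul_self]
    split_ifs
    · field_simp
    · simp
  simp only [WithLp.ofLp_sum, Finset.sum_apply, WithLp.ofLp_smul, Pi.smul_apply, bellCoeff,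
    bellVec, vectorize, PiLp.inner_apply, RCLike.inner_apply, Matrix.smul_apply, smul_eq_mul,
    Finset.sum_mul]
  rw [Finset.sum_comm]
  simp only [key]
  simp

theorem zString_eq_diagonal {n : ℕ} (s : Bits n) :
    zString s = Matrix.diagonal fun x => (-1 : ℂ) ^ (∑ i, (s i : ℕ) * (x i : ℕ)) := by
  have h1 : ∀ a b c : Fin 2, pauli (if a = 0 then 0 else 3) b c =
      if b = c then (-1 : ℂ) ^ ((a : ℕ) * (b : ℕ)) else 0 := by
    intro a b c
    fin_cases a <;> fin_cases b <;> fin_cases c <;> simp [pauli]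
  ext x y
  simp only [zString, pauliString, Matrix.of_apply, h1, Matrix.diagonal_apply]
  split_ifs with h
  · subst h
    simp [Finset.prod_pow_eq_pow_sum]
  · obtain ⟨i, hi⟩ := Function.ne_iff.mp h
    exact Finset.prod_eq_zero (Finset.mem_univ i) (if_neg hi)

/-- The numbers `walshCoeff γ s` are the coefficients of `∑ γ_x |x⟩⟨x|` in the normalized
operators `± zString s`, with the signs chosen to make the coefficients non-negative. -/
theorem diagonal_eq_sum_walshCoeff {n : ℕ} (γ : Bits n → ℝ) :
    ∃ ε : Bits n → ℂ, (∀ s, ε s = 1 ∨ ε s = -1) ∧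
      Matrix.diagonal (fun x => (γ x : ℂ)) =
        (normFactor n : ℂ) • ∑ s, (walshCoeff γ s : ℂ) • (ε s • zString s) := by
  set w : Bits n → ℝ := fun s =>
    normFactor n * ∑ x, (-1) ^ (∑ i, (s i : ℕ) * (x i : ℕ)) * γ x with hw
  refine ⟨fun s => if 0 ≤ w s then 1 else -1, fun s => by dsimp only; split_ifs <;> simp, ?_⟩
  have h1 : ∀ s, (walshCoeff γ s : ℂ) * (if 0 ≤ w s then 1 else -1) = (w s : ℂ) := by
    intro s
    change ((|w s| : ℝ) : ℂ) * _ = _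
    split_ifs with h
    · rw [abs_of_nonneg h, mul_one]
    · rw [abs_of_neg (not_le.mp h)]
      push_cast
      ring
  have orth : ∀ x y : Bits n, ∑ s : Bits n, (-1 : ℂ) ^ (∑ i, (s i : ℕ) * (x i : ℕ)) *
      (-1 : ℂ) ^ (∑ i, (s i : ℕ) * (y i : ℕ)) = if x = y then 2 ^ n else 0 := by
    intro x y
    have h2 : ∀ a b : Fin 2, ∑ t : Fin 2, (-1 : ℂ) ^ ((t : ℕ) * (a : ℕ)) *
        (-1 : ℂ) ^ ((t : ℕ) * (b : ℕ)) = if a = b then 2 else 0 := by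
      intro a b
      fin_cases a <;> fin_cases b <;> simp [Fin.sum_univ_two]
      all_goals norm_num
    simp only [← Finset.prod_pow_eq_pow_sum, ← Finset.prod_mul_distrib]
    rw [← Fintype.piFinset_univ, ← Finset.prod_univ_sum (fun _ => Finset.univ)
      (fun i t => (-1 : ℂ) ^ ((t : Fin 2) * (x i : ℕ) : ℕ) * (-1 : ℂ) ^ ((t : ℕ) * (y i : ℕ)))]
    simp only [h2]
    split_ifs with h
    · subst h
      simp
    · obtain ⟨i, hi⟩ := Function.ne_iff.mp h
      exact Finset.prod_eq_zero (Finset.mem_univ i) (if_neg hi)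
  simp only [smul_smul, h1, zString_eq_diagonal]
  ext y z
  simp only [Matrix.smul_apply, Matrix.sum_apply, Matrix.diagonal_apply, smul_eq_mul]
  split_ifs with hyz
  · have h3 : ∀ s, (w s : ℂ) * (-1) ^ (∑ i, (s i : ℕ) * (y i : ℕ)) =
        ∑ x, (normFactor n * γ x : ℂ) * ((-1 : ℂ) ^ (∑ i, (s i : ℕ) * (x i : ℕ)) *
          (-1 : ℂ) ^ (∑ i, (s i : ℕ) * (y i : ℕ))) := by
      intro s
      simp only [hw]
      push_cast
      rw [Finset.mul_sum, Finset.sum_mul]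
      exact Finset.sum_congr rfl fun x _ => by ring
    simp only [h3]
    rw [Finset.sum_comm]
    simp only [← Finset.mul_sum, orth]
    simp only [mul_ite, mul_zero, Finset.sum_ite_eq', Finset.mem_univ, if_true]
    rw [show (normFactor n : ℂ) * (normFactor n * γ y * 2 ^ n) =
      (normFactor n * normFactor n) * (γ y * 2 ^ n) by ring, normFactor_mul_self]
    field_simp
  · simp

/-- Every operator has a Schmidt decomposition across the time bipartition. -/
theorem exists_isTimeSchmidt {n : ℕ} (O : QubitOp n) : ∃ γ, IsTimeSchmidt (vectorize O) γ := by
  have hH : (O.conjTranspose * O).IsHermitian := Matrix.isHermitian_conjTranspose_mul_self O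
  set v := hH.eigenvectorBasis
  set T : EuclideanSpace ℂ (Bits n) →ₗ[ℂ] EuclideanSpace ℂ (Bits n) := Matrix.toEuclideanLin O
  have hin : ∀ i j, inner ℂ (T (v i)) (T (v j)) = if i = j then (hH.eigenvalues j : ℂ) else 0 := by
    intro i j
    have h1 : inner ℂ (T (v i)) (T (v j)) =
        inner ℂ (v i) (Matrix.toEuclideanLin O.conjTranspose (T (v j))) := by
      rw [Matrix.toEuclideanLin_conjTranspose_eq_adjoint, LinearMap.adjoint_inner_right]
    have h2 : Matrix.toEuclideanLin O.conjTranspose (T (v j)) =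
        (hH.eigenvalues j : ℂ) • v j := by
      have := hH.mulVec_eigenvectorBasis j
      ext x
      have h3 := congrFun this x
      rw [← Matrix.mulVec_mulVec] at h3
      exact h3
    rw [h1, h2, inner_smul_right, orthonormal_iff_ite.mp v.orthonormal i j]
    simp
  have hnn : ∀ i, 0 ≤ hH.eigenvalues i := by
    intro i
    have h1 : (‖T (v i)‖ : ℂ) ^ 2 = (hH.eigenvalues i : ℂ) :=
      (inner_self_eq_norm_sq_to_K (𝕜 := ℂ) (T (v i))).symm.trans ((hin i i).trans (if_pos rfl))
    have h2 : ‖T (v i)‖ ^ 2 = hH.eigenvalues i := by exact_mod_cast h1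
    rw [← h2]
    positivity
  set γ : Bits n → ℝ := fun i => √(hH.eigenvalues i)
  have hγ : ∀ i, (γ i : ℂ) * γ i = (hH.eigenvalues i : ℂ) := fun i => by
    rw [← Complex.ofReal_mul, Real.mul_self_sqrt (hnn i)]
  have horth : Orthonormal ℂ (Set.domRestrict {i | γ i ≠ 0} fun i => ((γ i : ℂ)⁻¹) • T (v i)) := by
    rw [orthonormal_iff_ite]
    rintro ⟨i, hi⟩ ⟨j, hj⟩
    have hj' : (γ j : ℂ) ≠ 0 := Complex.ofReal_ne_zero.mpr hj
    simp only [Set.domRestrict_apply, inner_smul_left, inner_smul_right, hin, Subtype.mk.injEq]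
    split_ifs with h
    · subst h
      rw [← hγ, map_inv₀, Complex.conj_ofReal]
      field_simp
    · simp
  obtain ⟨u, hu⟩ := horth.exists_orthonormalBasis_extension_of_card_eq (by simp)
  have hTv : ∀ k, T (v k) = (γ k : ℂ) • u k := by
    intro k
    by_cases hk : γ k = 0
    · have h0 : inner ℂ (T (v k)) (T (v k)) = 0 := by
        rw [hin, if_pos rfl, ← hγ, hk]
        simp
      rw [inner_self_eq_zero.mp h0, hk]
      simp
    · rw [hu k hk, smul_smul, mul_inv_cancel₀ (Complex.ofReal_ne_zero.mpr hk), one_smul]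
  refine ⟨γ, fun k => Real.sqrt_nonneg _, u,
    fun k => WithLp.toLp 2 fun j => (starRingEnd ℂ) (v k j), u.orthonormal, ?_, ?_⟩
  · rw [orthonormal_iff_ite]
    intro i j
    have := orthonormal_iff_ite.mp v.orthonormal j i
    simp only [PiLp.inner_apply, RCLike.inner_apply] at this ⊢
    simp only [eq_comm (a := i) (b := j), ← this]
    exact Finset.sum_congr rfl fun x _ => by simp [mul_comm]
  · intro i j
    have h1 : T (EuclideanSpace.single j 1) = ∑ k, (starRingEnd ℂ) (v k j) • T (v k) := by
      conv_lhs => rw [← v.sum_repr' (EuclideanSpace.single j 1)]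
      simp [EuclideanSpace.inner_single_right]
    have h2 : O i j = T (EuclideanSpace.single j 1) i := by
      simp [T, Matrix.toLpLin_apply]
    change O i j = _
    rw [h2, h1]
    simp only [hTv, WithLp.ofLp_sum, Finset.sum_apply, WithLp.ofLp_smul, Pi.smul_apply,
      smul_eq_mul]
    exact Finset.sum_congr rfl fun k _ => by ring

end OperatorEntropy

/-! Both inequalities are instances of the Maassen–Uffink relation: if `b = U a` with unit vectors
`a`, `b`, orthonormal columns of `U` and all entries of `U` bounded by `c`, then conjugate-order
entropies of `|a|²` and `|b|²` add up to at least `-2 log₂ c`. For Pauli strings and for Walsh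
characters alike the entries are bounded by `c = 2^(-n/2)`, so the bound is `n`.

The analytic core is `norm_bilin_le_interp`, a Riesz–Thorin bound for the bilinear form of `U`.
Testing it against the vector dual to `b` bounds an `ℓ^(2β)` norm of `b` by an `ℓ^(2α)` norm of `a`,
and its logarithm is the entropy inequality for `α < 1 < β` (`maassen_uffink_interior`). The Shannon
case is a limit, the case `{1/2, ∞}` is the trivial `ℓ¹ → ℓ^∞` bound, and `α > 1` follows by passing
to the adjoint of `U`. -/

namespace OperatorEntropy

/-! ### Riesz–Thorin interpolation via the three lines theorem -/

section Interpolation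

variable {ι κ : Type} [Fintype ι] [Fintype κ]

/-- Gives a bound free of the exponent, hence uniform over the closed strip, as the three lines
theorem requires. -/
theorem rpow_le_one_add_sq {x e : ℝ} (hx : 0 ≤ x) (he : 0 ≤ e) (he2 : e ≤ 2) :
    x ^ e ≤ 1 + x ^ 2 := by
  rcases le_total x 1 with h | h
  · have := Real.rpow_le_one hx h he
    nlinarith [sq_nonneg x]
  · have := Real.rpow_le_rpow_of_exponent_le h he2
    rw [Real.rpow_two] at this
    linarith

theorem exists_unit_factor (a : ℂ) : ∃ u : ℂ, ‖u‖ ≤ 1 ∧ u * (‖a‖ : ℂ) = a := by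
  by_cases h : a = 0
  · exact ⟨0, by simp, by simp [h]⟩
  · have h' : (‖a‖ : ℂ) ≠ 0 := by simpa using h
    refine ⟨a / ‖a‖, ?_, div_mul_cancel₀ _ h'⟩
    rw [norm_div, Complex.norm_real, norm_norm, div_self (by simpa using h)]

/-- Riesz–Thorin interpolation between the bounds `ℓ² × ℓ² → ℂ` and `ℓ¹ × ℓ¹ → ℂ` of a bilinear
form. -/
theorem norm_bilin_le_interp (U : κ → ι → ℂ) {c : ℝ} (hc : 0 ≤ c) (hU : ∀ k i, ‖U k i‖ ≤ c)
    (hU2 : ∀ (g : κ → ℂ) (f : ι → ℂ),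
      ‖∑ k, ∑ i, g k * U k i * f i‖ ≤ √(∑ k, ‖g k‖ ^ 2) * √(∑ i, ‖f i‖ ^ 2))
    {t : ℝ} (ht0 : 0 ≤ t) (ht1 : t ≤ 1) (g : κ → ℂ) (f : ι → ℂ) :
    ‖∑ k, ∑ i, g k * U k i * f i‖ ≤
      c ^ t * (∑ k, ‖g k‖ ^ (2 / (1 + t))) ^ ((1 + t) / 2) *
        (∑ i, ‖f i‖ ^ (2 / (1 + t))) ^ ((1 + t) / 2) := by
  have ht : 0 < 1 + t := by linarith
  set s : ℝ := 1 / (1 + t) with hs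
  have hs0 : 0 < s := by positivity
  have hs1 : s ≤ 1 := by rw [hs, div_le_one ht]; linarith
  have hst : s * (1 + t) = 1 := by rw [hs]; field_simp
  have h2s : 2 / (1 + t) = 2 * s := by rw [hs]; ring
  rw [h2s]
  set P := ∑ i, ‖f i‖ ^ (2 * s)
  set Q := ∑ k, ‖g k‖ ^ (2 * s)
  have hP : 0 ≤ P := by positivity
  have hQ : 0 ≤ Q := by positivity
  choose u hu hua using fun i => exists_unit_factor (f i)
  choose v hv hva using fun k => exists_unit_factor (g k)
  -- The exponent is chosen so that `e t = 1` recovers `f` and `g`. On `Re z = 0` the squared `ℓ²`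
  -- norms of `f' z`, `g' z` are at most `P`, `Q`; on `Re z = 1` the same holds of their `ℓ¹` norms.
  set e : ℂ → ℂ := fun z => (s : ℂ) * (1 + z) with he
  have here : ∀ z : ℂ, (e z).re = s * (1 + z.re) := fun z => by simp [he]
  set f' : ℂ → ι → ℂ := fun z i => u i * (‖f i‖ : ℂ) ^ e z
  set g' : ℂ → κ → ℂ := fun z k => v k * (‖g k‖ : ℂ) ^ e z
  have hpow : ∀ {w : ℂ} {x : ℝ} {z : ℂ}, ‖w‖ ≤ 1 → 0 ≤ x → 0 ≤ z.re →
      ‖w * (x : ℂ) ^ e z‖ ≤ x ^ (s * (1 + z.re)) := by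
    intro w x z hw hx hz
    rw [norm_mul, Complex.norm_cpow_eq_rpow_re_of_nonneg hx (by rw [here]; positivity), here]
    exact mul_le_of_le_one_left (by positivity) hw
  have hf' : ∀ z i, 0 ≤ z.re → ‖f' z i‖ ≤ ‖f i‖ ^ (s * (1 + z.re)) := fun z i hz =>
    hpow (hu i) (norm_nonneg _) hz
  have hg' : ∀ z k, 0 ≤ z.re → ‖g' z k‖ ≤ ‖g k‖ ^ (s * (1 + z.re)) := fun z k hz =>
    hpow (hv k) (norm_nonneg _) hz
  set F : ℂ → ℂ := fun z => ∑ k, ∑ i, g' z k * U k i * f' z i with hF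
  have het : e t = 1 := by
    simp only [he]
    exact_mod_cast hst
  have hFt : F t = ∑ k, ∑ i, g k * U k i * f i := by
    simp only [hF, f', g', het, Complex.cpow_one, hua, hva]
  have hnorm : ∀ z, ‖F z‖ ≤ ∑ k, ∑ i, ‖g' z k‖ * c * ‖f' z i‖ := by
    intro z
    refine (norm_sum_le _ _).trans (Finset.sum_le_sum fun k _ => (norm_sum_le _ _).trans
      (Finset.sum_le_sum fun i _ => ?_))
    rw [norm_mul, norm_mul]
    gcongr
    exact hU k i
  -- The base may be `0`; the power is still differentiable because the exponent has positive real
  -- part.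
  have hdiff : ∀ (x : ℝ) (z : ℂ), 0 ≤ z.re → DifferentiableAt ℂ (fun z => (x : ℂ) ^ e z) z := by
    intro x z hz
    refine DifferentiableAt.const_cpow (by fun_prop) (Or.inr fun h => ?_)
    have := here z
    rw [h, Complex.zero_re] at this
    have : 0 < s * (1 + z.re) := by positivity
    linarith
  have hd : DiffContOnCl ℂ F (Complex.HadamardThreeLines.verticalStrip 0 1) := by
    have h1 : DifferentiableOn ℂ F (closure (Complex.HadamardThreeLines.verticalStrip 0 1)) := by
      intro z hz
      have hz0 : 0 ≤ z.re := by
        rw [Complex.HadamardThreeLines.verticalStrip, Complex.closure_preimage_re,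
          closure_Ioo zero_ne_one] at hz
        exact hz.1
      refine DifferentiableAt.differentiableWithinAt ?_
      refine DifferentiableAt.fun_sum fun k _ => DifferentiableAt.fun_sum fun i _ => ?_
      exact (((hdiff _ z hz0).const_mul _).mul_const _).mul ((hdiff _ z hz0).const_mul _)
    exact h1.diffContOnCl
  have hB : BddAbove ((norm ∘ F) '' Complex.HadamardThreeLines.verticalClosedStrip 0 1) := by
    refine ⟨∑ k, ∑ i, (1 + ‖g k‖ ^ 2) * c * (1 + ‖f i‖ ^ 2), ?_⟩
    rintro _ ⟨z, ⟨hz0, hz1⟩, rfl⟩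
    refine (hnorm z).trans (Finset.sum_le_sum fun k _ => Finset.sum_le_sum fun i _ => ?_)
    have h1 : s * (1 + z.re) ≤ 2 := by nlinarith
    have h0 : 0 ≤ s * (1 + z.re) := by positivity
    gcongr
    · exact (hg' z k hz0).trans (rpow_le_one_add_sq (norm_nonneg _) h0 h1)
    · exact (hf' z i hz0).trans (rpow_le_one_add_sq (norm_nonneg _) h0 h1)
  have hl : ∀ z ∈ Complex.re ⁻¹' {0}, ‖F z‖ ≤ √Q * √P := by
    intro z hz
    have hz : z.re = 0 := hz
    refine (hU2 (g' z) (f' z)).trans ?_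
    have hsq : ∀ {x y : ℝ}, 0 ≤ x → 0 ≤ y → y ≤ x ^ (s * (1 + z.re)) → y ^ 2 ≤ x ^ (2 * s) := by
      intro x y hx hy h
      rw [hz, add_zero, mul_one] at h
      rw [mul_comm, Real.rpow_mul hx, Real.rpow_two]
      gcongr
    gcongr
    · exact Finset.sum_le_sum fun k _ => hsq (norm_nonneg _) (norm_nonneg _) (hg' z k hz.ge)
    · exact Finset.sum_le_sum fun k _ => hsq (norm_nonneg _) (norm_nonneg _) (hf' z k hz.ge)
  have hr : ∀ z ∈ Complex.re ⁻¹' {1}, ‖F z‖ ≤ c * (Q * P) := by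
    intro z hz
    have hz : z.re = 1 := hz
    have hs2 : s * (1 + z.re) = 2 * s := by rw [hz]; ring
    have hz0 : 0 ≤ z.re := by rw [hz]; exact zero_le_one
    refine (hnorm z).trans ?_
    rw [Finset.sum_mul_sum, Finset.mul_sum]
    simp only [Finset.mul_sum]
    refine Finset.sum_le_sum fun k _ => Finset.sum_le_sum fun i _ => ?_
    rw [mul_comm _ c, mul_assoc, ← hs2]
    gcongr
    · exact hg' z k hz0
    · exact hf' z i hz0
  have key := Complex.HadamardThreeLines.norm_le_interp_of_mem_verticalClosedStrip₀₁' F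
    (z := t) ⟨by simpa using ht0, by simpa using ht1⟩ hd hB hl hr
  rw [hFt, Complex.ofReal_re] at key
  refine key.trans_eq ?_
  -- The exponents of `Q * P` combine as `(1 - t) / 2 + t = (1 + t) / 2`.
  have hQP : 0 ≤ Q * P := by positivity
  rw [← Real.sqrt_mul hQ, Real.sqrt_eq_rpow, ← Real.rpow_mul hQP, Real.mul_rpow hc hQP, mul_left_comm,
    ← Real.rpow_add_of_nonneg hQP (by linarith) ht0, mul_assoc, ← Real.mul_rpow hQ hP]
  congr 2
  ring

end Interpolation

/-! ### Shannon entropy as a limit of Rényi entropies -/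

section Renyi

variable {ι κ : Type} [Fintype ι] [Fintype κ]

open Filter Topology in
/-- The Rényi entropies converge to the Shannon entropy as the order tends to `1`. -/
theorem tendsto_renyi_shannon {p : ι → ℝ} (hp : ∀ i, 0 ≤ p i) (hsum : ∑ i, p i = 1) :
    Tendsto (fun s : ℝ => 1 / (1 - s) * Real.logb 2 (∑ i, p i ^ s)) (𝓝[≠] 1)
      (𝓝 (-∑ i, p i * Real.logb 2 (p i))) := by
  have h1 : ∀ i, HasDerivAt (fun s : ℝ => p i ^ s) (p i * Real.log (p i)) 1 := by
    intro i
    rcases (hp i).eq_or_lt with h | h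
    · rw [← h, zero_mul]
      refine (hasDerivAt_const (1 : ℝ) (0 : ℝ)).congr_of_eventuallyEq ?_
      filter_upwards [isOpen_ne.mem_nhds (one_ne_zero (α := ℝ))] with s hs
      exact Real.zero_rpow hs
    · simpa using (Real.hasStrictDerivAt_const_rpow h 1).hasDerivAt
  have h2 : HasDerivAt (fun s : ℝ => ∑ i, p i ^ s) (∑ i, p i * Real.log (p i)) 1 :=
    HasDerivAt.fun_sum fun i _ => h1 i
  have hS1 : ∑ i, p i ^ (1 : ℝ) = 1 := by simpa using hsum
  have h3 := (h2.log (by rw [hS1]; exact one_ne_zero)).div_const (Real.log 2)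
  rw [hS1, div_one] at h3
  -- Since `∑ p i = 1`, the Rényi entropy of order `s` is minus the slope of `s ↦ log₂ ∑ p i ^ s`
  -- between `1` and `s`.
  have h4 := h3.tendsto_slope.neg
  refine (h4.congr' ?_).trans_eq ?_
  · filter_upwards [self_mem_nhdsWithin] with s hs
    have hs' : s - 1 ≠ 0 := sub_ne_zero.mpr hs
    have hs'' : 1 - s ≠ 0 := sub_ne_zero.mpr (Ne.symm hs)
    rw [slope_def_field, hS1, Real.logb, Real.log_one]
    rw [← neg_sub s 1]
    field_simp
    ring
  · simp only [Real.logb, mul_div_assoc', Finset.sum_div]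

end Renyi

/-! ### The Maassen–Uffink relation -/

section MaassenUffink

variable {ι κ : Type} [Fintype ι] [Fintype κ]

theorem sq_rpow_eq {x : ℝ} (hx : 0 ≤ x) (s : ℝ) : (x ^ 2) ^ s = x ^ (2 * s) := by
  rw [Real.rpow_mul hx, Real.rpow_two]

theorem sum_rpow_pos {a : ι → ℂ} (ha : ∑ i, ‖a i‖ ^ 2 = 1) (s : ℝ) :
    0 < ∑ i, (‖a i‖ ^ 2) ^ s := by
  obtain ⟨i, hi⟩ : ∃ i, a i ≠ 0 := by
    by_contra! h
    simp [h] at ha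
  refine Finset.sum_pos' (fun i _ => by positivity) ⟨i, Finset.mem_univ i, ?_⟩
  have : 0 < ‖a i‖ := norm_pos_iff.mpr hi
  positivity

theorem maassen_uffink_interior (U : κ → ι → ℂ) {c : ℝ} (hc : 0 < c) (hU : ∀ k i, ‖U k i‖ ≤ c)
    (hU2 : ∀ (g : κ → ℂ) (f : ι → ℂ),
      ‖∑ k, ∑ i, g k * U k i * f i‖ ≤ √(∑ k, ‖g k‖ ^ 2) * √(∑ i, ‖f i‖ ^ 2))
    {a : ι → ℂ} {b : κ → ℂ} (hab : ∀ k, b k = ∑ i, U k i * a i)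
    (ha : ∑ i, ‖a i‖ ^ 2 = 1) (hb : ∑ k, ‖b k‖ ^ 2 = 1)
    {x y : ℝ} (hx : 0 < x) (hx1 : x < 1) (hy : 1 < y) (hxy : 1 / x + 1 / y = 2) :
    -(2 * Real.logb 2 c) ≤ 1 / (1 - x) * Real.logb 2 (∑ i, (‖a i‖ ^ 2) ^ x) +
      1 / (1 - y) * Real.logb 2 (∑ k, (‖b k‖ ^ 2) ^ y) := by
  -- Conjugate orders are parametrized by `1 / x = 1 + t`, `1 / y = 1 - t`.
  obtain ⟨t, ht⟩ : ∃ t, t = 1 / x - 1 := ⟨_, rfl⟩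
  have hxt : x = 1 / (1 + t) := by rw [ht]; simp
  have hyt : y = 1 / (1 - t) := by
    rw [ht, show 1 - (1 / x - 1) = 1 / y by linarith, one_div_one_div]
  have ht0 : 0 < t := by rw [ht, sub_pos, lt_div_iff₀ hx]; linarith
  have ht1 : t < 1 := by
    have : 0 < 1 / y := by positivity
    linarith
  have h1t : 0 < 1 - t := by linarith
  set A := ∑ i, (‖a i‖ ^ 2) ^ x with hA
  set B := ∑ k, (‖b k‖ ^ 2) ^ y with hB
  have hA0 : 0 < A := sum_rpow_pos ha x
  have hB0 : 0 < B := sum_rpow_pos hb y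
  -- With this `r`, both `2 + r` and `(1 + r) * (2 / (1 + t))` equal `2 * y`. So pairing `g` with
  -- `b` gives `B`, and the power sum of `g` in the interpolation bound is `B` too.
  set r : ℝ := 2 * t / (1 - t) with hr
  have hr0 : 0 ≤ r := by positivity
  set g : κ → ℂ := fun k => (starRingEnd ℂ) (b k) * ((‖b k‖ ^ r : ℝ) : ℂ)
  have hgn : ∀ k, ‖g k‖ = ‖b k‖ ^ (1 + r) := by
    intro k
    rw [norm_mul, Complex.norm_conj, Complex.norm_real, Real.norm_of_nonneg (by positivity),
      Real.rpow_add_of_nonneg (norm_nonneg _) zero_le_one hr0, Real.rpow_one]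
  have key := norm_bilin_le_interp U hc.le hU hU2 ht0.le ht1.le g a
  have e1 : ∑ i, ‖a i‖ ^ (2 / (1 + t)) = A := by
    refine Finset.sum_congr rfl fun i _ => ?_
    rw [sq_rpow_eq (norm_nonneg _), hxt]
    congr 1
    ring
  have e2 : ∑ k, ‖g k‖ ^ (2 / (1 + t)) = B := by
    refine Finset.sum_congr rfl fun k _ => ?_
    rw [sq_rpow_eq (norm_nonneg _), hyt, hgn, ← Real.rpow_mul (norm_nonneg _), hr]
    congr 1
    field_simp
    ring
  have e3 : ∑ k, ∑ i, g k * U k i * a i = (B : ℂ) := by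
    rw [hB]
    push_cast
    refine Finset.sum_congr rfl fun k _ => ?_
    simp only [mul_assoc, ← Finset.mul_sum]
    rw [← hab, sq_rpow_eq (norm_nonneg _), hyt, show 2 * (1 / (1 - t)) = 2 + r by
      rw [hr]; field_simp; ring, Real.rpow_add_of_nonneg (norm_nonneg _) zero_le_two hr0,
      Real.rpow_two, mul_right_comm, ← Complex.normSq_eq_conj_mul_self, Complex.normSq_eq_norm_sq]
    push_cast
    ring
  rw [e1, e2, e3, Complex.norm_real, Real.norm_of_nonneg hB0.le] at key
  -- `key` reads `B ≤ c ^ t * B ^ ((1 + t) / 2) * A ^ ((1 + t) / 2)`; taking logarithms and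
  -- multiplying by `2 / t` gives the claim.
  have hlog := Real.logb_le_logb_of_le one_lt_two hB0 key
  rw [Real.logb_mul (by positivity) (by positivity), Real.logb_mul (by positivity) (by positivity),
    Real.logb_rpow_eq_mul_logb_of_pos hc, Real.logb_rpow_eq_mul_logb_of_pos hB0,
    Real.logb_rpow_eq_mul_logb_of_pos hA0] at hlog
  have c1 : 1 / (1 - x) = (1 + t) / t := by
    rw [hxt, show 1 - 1 / (1 + t) = t / (1 + t) by field_simp; ring, one_div_div]
  have c2 : 1 / (1 - y) = -(1 - t) / t := by
    rw [hyt, show 1 - 1 / (1 - t) = -t / (1 - t) by field_simp; ring]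
    field_simp
  rw [c1, c2, div_mul_eq_mul_div, div_mul_eq_mul_div, ← add_div, le_div_iff₀ ht0]
  linarith

/-- The limit `t → 0⁺` of the interior case along the conjugate orders `1 / (1 + t)` and `1 / (1 -
t)`. -/
theorem maassen_uffink_shannon (U : κ → ι → ℂ) {c : ℝ} (hc : 0 < c) (hU : ∀ k i, ‖U k i‖ ≤ c)
    (hU2 : ∀ (g : κ → ℂ) (f : ι → ℂ),
      ‖∑ k, ∑ i, g k * U k i * f i‖ ≤ √(∑ k, ‖g k‖ ^ 2) * √(∑ i, ‖f i‖ ^ 2))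
    {a : ι → ℂ} {b : κ → ℂ} (hab : ∀ k, b k = ∑ i, U k i * a i)
    (ha : ∑ i, ‖a i‖ ^ 2 = 1) (hb : ∑ k, ‖b k‖ ^ 2 = 1) :
    -(2 * Real.logb 2 c) ≤ -∑ i, ‖a i‖ ^ 2 * Real.logb 2 (‖a i‖ ^ 2) +
      -∑ k, ‖b k‖ ^ 2 * Real.logb 2 (‖b k‖ ^ 2) := by
  have hcont : ∀ ε : ℝ, Filter.Tendsto (fun t : ℝ => 1 / (1 + ε * t)) (nhdsWithin 0 (Set.Ioi 0))
      (nhds 1) := by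
    intro ε
    have : ContinuousAt (fun t : ℝ => 1 / (1 + ε * t)) 0 :=
      ContinuousAt.div (by fun_prop) (by fun_prop) (by simp)
    simpa using this.tendsto.mono_left nhdsWithin_le_nhds
  have hmem : ∀ᶠ t : ℝ in nhdsWithin 0 (Set.Ioi 0), t ∈ Set.Ioo (0 : ℝ) 1 :=
    Ioo_mem_nhdsGT zero_lt_one
  have hlt : ∀ {t : ℝ}, t ∈ Set.Ioo (0 : ℝ) 1 → 0 < 1 / (1 + 1 * t) ∧ 1 / (1 + 1 * t) < 1 ∧
      1 < 1 / (1 + (-1) * t) := by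
    rintro t ⟨h0, h1⟩
    refine ⟨by positivity, ?_, ?_⟩
    · rw [div_lt_one (by positivity)]; linarith
    · rw [lt_div_iff₀ (by linarith)]; linarith
  have hA := (tendsto_renyi_shannon (fun i => sq_nonneg ‖a i‖) ha).comp
    (tendsto_nhdsWithin_iff.mpr ⟨hcont 1, hmem.mono fun t ht => (hlt ht).2.1.ne⟩)
  have hB := (tendsto_renyi_shannon (fun k => sq_nonneg ‖b k‖) hb).comp
    (tendsto_nhdsWithin_iff.mpr ⟨hcont (-1), hmem.mono fun t ht => (hlt ht).2.2.ne'⟩)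
  refine ge_of_tendsto (hA.add hB) (hmem.mono fun t ht => ?_)
  obtain ⟨h1, h2, h3⟩ := hlt ht
  refine maassen_uffink_interior U hc hU hU2 hab ha hb h1 h2 h3 ?_
  rw [one_div_one_div, one_div_one_div]
  ring

/-- The triangle inequality gives `‖b k‖ ≤ c * ∑ ‖a i‖`; no interpolation is involved. -/
theorem maassen_uffink_endpoint (U : κ → ι → ℂ) {c : ℝ} (hc : 0 < c) (hU : ∀ k i, ‖U k i‖ ≤ c)
    {a : ι → ℂ} {b : κ → ℂ} (hab : ∀ k, b k = ∑ i, U k i * a i)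
    (ha : ∑ i, ‖a i‖ ^ 2 = 1) (hb : ∑ k, ‖b k‖ ^ 2 = 1) :
    -(2 * Real.logb 2 c) ≤ 2 * Real.logb 2 (∑ i, (‖a i‖ ^ 2) ^ (1 / 2 : ℝ)) +
      -Real.logb 2 (⨆ k, ‖b k‖ ^ 2) := by
  have hS := sum_rpow_pos ha (1 / 2)
  have h2 : ∑ i, (‖a i‖ ^ 2) ^ (1 / 2 : ℝ) = ∑ i, ‖a i‖ := by
    refine Finset.sum_congr rfl fun i _ => ?_
    rw [sq_rpow_eq (norm_nonneg _)]
    norm_num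
  rw [h2] at hS ⊢
  obtain ⟨k, hk⟩ : ∃ k, b k ≠ 0 := by
    by_contra! h
    simp [h] at hb
  have : Nonempty κ := ⟨k⟩
  have hpos : 0 < ⨆ k, ‖b k‖ ^ 2 :=
    (by positivity : 0 < ‖b k‖ ^ 2).trans_le
      (le_ciSup (f := fun k => ‖b k‖ ^ 2) (Set.finite_range _).bddAbove k)
  have hle : ⨆ k, ‖b k‖ ^ 2 ≤ (c * ∑ i, ‖a i‖) ^ 2 := by
    refine ciSup_le fun k => ?_
    gcongr
    rw [hab, Finset.mul_sum]
    refine (norm_sum_le _ _).trans (Finset.sum_le_sum fun i _ => ?_)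
    rw [norm_mul]
    gcongr
    exact hU k i
  have hlog := Real.logb_le_logb_of_le one_lt_two hpos hle
  rw [Real.logb_pow, Real.logb_mul hc.ne' hS.ne'] at hlog
  push_cast at hlog
  linarith

theorem renyiEntropy_of_real {x : ℝ} (hx : 0 ≤ x) (hx1 : x ≠ 1) (p : ι → ℝ) :
    renyiEntropy (ENNReal.ofReal x) p = 1 / (1 - x) * Real.logb 2 (∑ i, p i ^ x) := by
  have h1 : ENNReal.ofReal x ≠ 1 := by simpa using hx1
  rw [renyiEntropy, if_neg h1, if_neg ENNReal.ofReal_ne_top, ENNReal.toReal_ofReal hx]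

theorem renyiEntropy_one (p : ι → ℝ) :
    renyiEntropy 1 p = -∑ i, p i * Real.logb 2 (p i) := if_pos rfl

theorem renyiEntropy_top (p : ι → ℝ) : renyiEntropy ∞ p = -Real.logb 2 (⨆ i, p i) := by
  rw [renyiEntropy, if_neg ENNReal.top_ne_one, if_pos rfl]

theorem renyiEntropy_half (p : ι → ℝ) :
    renyiEntropy 2⁻¹ p = 2 * Real.logb 2 (∑ i, p i ^ (1 / 2 : ℝ)) := by
  have h : (2⁻¹ : ℝ≥0∞) = ENNReal.ofReal (1 / 2) := by
    rw [one_div, ENNReal.ofReal_inv_of_pos two_pos, ENNReal.ofReal_ofNat]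
  rw [h, renyiEntropy_of_real (by norm_num) (by norm_num)]
  norm_num

/-- The Maassen–Uffink relation for Rényi entropies of conjugate orders. -/
theorem neg_two_logb_le_renyiEntropy_add (U : κ → ι → ℂ) {c : ℝ} (hc : 0 < c)
    (hU : ∀ k i, ‖U k i‖ ≤ c)
    (hU2 : ∀ (g : κ → ℂ) (f : ι → ℂ),
      ‖∑ k, ∑ i, g k * U k i * f i‖ ≤ √(∑ k, ‖g k‖ ^ 2) * √(∑ i, ‖f i‖ ^ 2))
    {a : ι → ℂ} {b : κ → ℂ} (hab : ∀ k, b k = ∑ i, U k i * a i)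
    (hba : ∀ i, a i = ∑ k, (starRingEnd ℂ) (U k i) * b k)
    (ha : ∑ i, ‖a i‖ ^ 2 = 1) (hb : ∑ k, ‖b k‖ ^ 2 = 1)
    {α β : ℝ≥0∞} (hαβ : 1 / α + 1 / β = 2) :
    -(2 * Real.logb 2 c) ≤
      renyiEntropy α (fun i => ‖a i‖ ^ 2) + renyiEntropy β (fun k => ‖b k‖ ^ 2) := by
  have hV : ∀ i k, ‖(starRingEnd ℂ) (U k i)‖ ≤ c := fun i k => by
    rw [Complex.norm_conj]; exact hU k i
  -- The conjugate transpose inherits the bilinear bound; it is used when `α > 1`, where `a` and `b`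
  -- exchange roles.
  have hV2 : ∀ (g : ι → ℂ) (f : κ → ℂ), ‖∑ i, ∑ k, g i * (starRingEnd ℂ) (U k i) * f k‖ ≤
      √(∑ i, ‖g i‖ ^ 2) * √(∑ k, ‖f k‖ ^ 2) := by
    intro g f
    have h := hU2 (fun k => (starRingEnd ℂ) (f k)) (fun i => (starRingEnd ℂ) (g i))
    simp only [Complex.norm_conj] at h
    rw [mul_comm, ← Complex.norm_conj, Finset.sum_comm]
    convert h using 2
    simp only [map_sum, map_mul, Complex.conj_conj]
    exact Finset.sum_congr rfl fun k _ => Finset.sum_congr rfl fun i _ => by ring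
  simp only [one_div] at hαβ
  have hα0 : α ≠ 0 := by rintro rfl; simp at hαβ
  have hβ0 : β ≠ 0 := by rintro rfl; simp at hαβ
  rcases eq_or_ne α ∞ with rfl | hα
  · have : β = 2⁻¹ := by simpa using congrArg (·⁻¹) hαβ
    rw [this, renyiEntropy_top, renyiEntropy_half, add_comm]
    exact maassen_uffink_endpoint (fun i k => (starRingEnd ℂ) (U k i)) hc hV hba hb ha
  rcases eq_or_ne β ∞ with rfl | hβ
  · have : α = 2⁻¹ := by simpa using congrArg (·⁻¹) hαβ
    rw [this, renyiEntropy_top, renyiEntropy_half]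
    exact maassen_uffink_endpoint U hc hU hab ha hb
  obtain ⟨x, hx, rfl⟩ : ∃ x : ℝ, 0 < x ∧ α = ENNReal.ofReal x :=
    ⟨α.toReal, ENNReal.toReal_pos hα0 hα, (ENNReal.ofReal_toReal hα).symm⟩
  obtain ⟨y, hy, rfl⟩ : ∃ y : ℝ, 0 < y ∧ β = ENNReal.ofReal y :=
    ⟨β.toReal, ENNReal.toReal_pos hβ0 hβ, (ENNReal.ofReal_toReal hβ).symm⟩
  have hxy : 1 / x + 1 / y = 2 := by
    rw [← ENNReal.ofReal_inv_of_pos hx, ← ENNReal.ofReal_inv_of_pos hy,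
      ← ENNReal.ofReal_add (by positivity) (by positivity)] at hαβ
    have := congrArg ENNReal.toReal hαβ
    rw [ENNReal.toReal_ofReal (by positivity)] at this
    simpa using this
  have hlt : ∀ {x y : ℝ}, 0 < x → 0 < y → 1 / x + 1 / y = 2 → x < 1 → 1 < y := by
    intro x y hx hy h hx1
    have h1 : 1 < 1 / x := by rwa [lt_div_iff₀ hx, one_mul]
    by_contra! h2
    have h3 : 1 ≤ 1 / y := by rwa [le_div_iff₀ hy, one_mul]
    linarith
  rcases lt_trichotomy x 1 with h | rfl | h
  · have h' := hlt hx hy hxy h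
    rw [renyiEntropy_of_real hx.le h.ne, renyiEntropy_of_real hy.le h'.ne']
    exact maassen_uffink_interior U hc hU hU2 hab ha hb hx h h' hxy
  · have : y = 1 := by
      have : 1 / y = 1 := by linarith
      field_simp at this
      exact this.symm
    subst this
    rw [ENNReal.ofReal_one, renyiEntropy_one, renyiEntropy_one]
    exact maassen_uffink_shannon U hc hU hU2 hab ha hb
  · have h' : y < 1 := by
      by_contra! h2
      have h1 : 1 / x < 1 := by rwa [div_lt_one hx]
      have h3 : 1 / y ≤ 1 := by rwa [div_le_one hy]
      linarith
    rw [renyiEntropy_of_real hx.le h.ne', renyiEntropy_of_real hy.le h'.ne, add_comm]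
    rw [add_comm] at hxy
    exact maassen_uffink_interior (fun i k => (starRingEnd ℂ) (U k i)) hc hV hV2 hba hb ha hy h' h
      hxy

/-- The Maassen–Uffink relation for the matrix `U` of an isometry: the orthonormality of the
columns of `U` is the only property of `U` that is needed. -/
theorem neg_two_logb_le_renyiEntropy_add_of_isometry [DecidableEq ι] (U : κ → ι → ℂ) {c : ℝ}
    (hc : 0 < c) (hU : ∀ k i, ‖U k i‖ ≤ c)
    (horth : ∀ i j, ∑ k, (starRingEnd ℂ) (U k i) * U k j = if i = j then 1 else 0)
    {a : ι → ℂ} {b : κ → ℂ} (hab : ∀ k, b k = ∑ i, U k i * a i)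
    (ha : ∑ i, ‖a i‖ ^ 2 = 1) {α β : ℝ≥0∞} (hαβ : 1 / α + 1 / β = 2) :
    -(2 * Real.logb 2 c) ≤
      renyiEntropy α (fun i => ‖a i‖ ^ 2) + renyiEntropy β (fun k => ‖b k‖ ^ 2) := by
  have hinv : ∀ (f : ι → ℂ) (i : ι),
      ∑ k, (starRingEnd ℂ) (U k i) * ∑ j, U k j * f j = f i := by
    intro f i
    simp only [Finset.mul_sum, ← mul_assoc]
    rw [Finset.sum_comm]
    simp only [← Finset.sum_mul, horth]
    simp
  have hiso : ∀ f : ι → ℂ, ∑ k, ‖∑ i, U k i * f i‖ ^ 2 = ∑ i, ‖f i‖ ^ 2 := by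
    intro f
    have hsq : ∀ z : ℂ, ((‖z‖ ^ 2 : ℝ) : ℂ) = (starRingEnd ℂ) z * z := fun z => by
      rw [← Complex.normSq_eq_conj_mul_self, Complex.normSq_eq_norm_sq]
    apply Complex.ofReal_injective
    simp only [Complex.ofReal_sum, hsq]
    calc ∑ k, (starRingEnd ℂ) (∑ i, U k i * f i) * ∑ j, U k j * f j
        = ∑ k, ∑ i, (starRingEnd ℂ) (f i) * ((starRingEnd ℂ) (U k i) * ∑ j, U k j * f j) := by
          refine Finset.sum_congr rfl fun k _ => ?_
          rw [map_sum, Finset.sum_mul]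
          refine Finset.sum_congr rfl fun i _ => ?_
          rw [map_mul]
          ring
      _ = ∑ i, (starRingEnd ℂ) (f i) * f i := by
          rw [Finset.sum_comm]
          simp only [← Finset.mul_sum, hinv]
  refine neg_two_logb_le_renyiEntropy_add U hc hU (fun g f => ?_) hab (fun i => ?_) ha ?_ hαβ
  -- Cauchy–Schwarz in `k`, with the norm of `U f` replaced by that of `f`.
  · rw [← hiso f]
    refine le_trans ?_ (Real.sum_mul_le_sqrt_mul_sqrt _ _ _)
    refine (norm_sum_le _ _).trans (Finset.sum_le_sum fun k _ => ?_)
    simp only [mul_assoc]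
    rw [← Finset.mul_sum, norm_mul]
  · simp only [hab, hinv]
  · simp only [hab, hiso, ha]

end MaassenUffink

/-! ### Application to the Bell and Walsh–Hadamard bases -/

theorem normFactor_pos (n : ℕ) : 0 < normFactor n := by
  rw [normFactor]
  positivity

theorem neg_two_logb_normFactor (n : ℕ) : -(2 * Real.logb 2 (normFactor n)) = n := by
  rw [normFactor, Real.logb_inv, Real.sqrt_eq_rpow,
    Real.logb_rpow_eq_mul_logb_of_pos (by positivity), Real.logb_pow,
    Real.logb_self_eq_one one_lt_two]
  ring

theorem norm_pauli_le_one (k : Fin 4) (x y : Fin 2) : ‖pauli k x y‖ ≤ 1 := by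
  fin_cases k <;> fin_cases x <;> fin_cases y <;> simp [pauli]

theorem norm_pauliString_le_one {n : ℕ} (k : Fin n → Fin 4) (x y : Bits n) :
    ‖pauliString k x y‖ ≤ 1 := by
  rw [pauliString, Matrix.of_apply, norm_prod]
  exact Finset.prod_le_one (fun i _ => norm_nonneg _) fun i _ => norm_pauli_le_one _ _ _

/-- The sum over bit strings factors into one two-term sum per qubit. -/
theorem sum_walshChar_mul_walshChar {n : ℕ} (x y : Bits n) :
    ∑ s : Bits n, (-1 : ℂ) ^ (∑ i, (s i : ℕ) * (x i : ℕ)) *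
      (-1 : ℂ) ^ (∑ i, (s i : ℕ) * (y i : ℕ)) = if x = y then 2 ^ n else 0 := by
  have h2 : ∀ a b : Fin 2, ∑ t : Fin 2, (-1 : ℂ) ^ ((t : ℕ) * (a : ℕ)) *
      (-1 : ℂ) ^ ((t : ℕ) * (b : ℕ)) = if a = b then 2 else 0 := by
    intro a b
    fin_cases a <;> fin_cases b <;> simp [Fin.sum_univ_two]
    all_goals norm_num
  simp only [← Finset.prod_pow_eq_pow_sum, ← Finset.prod_mul_distrib]
  rw [← Fintype.piFinset_univ, ← Finset.prod_univ_sum (fun _ => Finset.univ)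
    (fun i t => (-1 : ℂ) ^ ((t : Fin 2) * (x i : ℕ) : ℕ) * (-1 : ℂ) ^ ((t : ℕ) * (y i : ℕ)))]
  simp only [h2]
  split_ifs with h
  · subst h
    simp
  · obtain ⟨i, hi⟩ := Function.ne_iff.mp h
    exact Finset.prod_eq_zero (Finset.mem_univ i) (if_neg hi)

theorem sum_norm_vectorize_sq {n : ℕ} {O : QubitOp n} (hO : ‖O‖ = 1) :
    ∑ x, ‖vectorize O x‖ ^ 2 = 1 := by
  rw [Matrix.frobenius_norm_def, ← Real.sqrt_eq_rpow, Real.sqrt_eq_one] at hO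
  simpa [vectorize, Fintype.sum_prod_type] using hO

/-- Pythagoras for the orthonormal product vectors `r k ⊗ c k`; all that the second inequality needs
from the Schmidt decomposition. -/
theorem IsTimeSchmidt.sum_sq {n : ℕ} {ψ : EuclideanSpace ℂ (Bits n × Bits n)} {γ : Bits n → ℝ}
    (h : IsTimeSchmidt ψ γ) : ∑ k, γ k ^ 2 = ∑ x, ‖ψ x‖ ^ 2 := by
  obtain ⟨-, r, c, hr, hc, hψ⟩ := h
  set e : Bits n → EuclideanSpace ℂ (Bits n × Bits n) :=
    fun k => WithLp.toLp 2 fun x => r k x.1 * c k x.2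
  have he : Orthonormal ℂ e := by
    rw [orthonormal_iff_ite] at hr hc ⊢
    intro k l
    have : inner ℂ (e k) (e l) = inner ℂ (r k) (r l) * inner ℂ (c k) (c l) := by
      simp only [e, PiLp.inner_apply, RCLike.inner_apply, Finset.sum_mul_sum,
        Fintype.sum_prod_type, map_mul]
      exact Finset.sum_congr rfl fun i _ => Finset.sum_congr rfl fun j _ => by ring
    rw [this, hr, hc]
    split_ifs <;> simp
  have hsum : ψ = ∑ k, (γ k : ℂ) • e k := by
    ext ⟨i, j⟩
    simp [e, hψ, WithLp.ofLp_sum, Finset.sum_apply]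
  rw [← EuclideanSpace.norm_sq_eq, hsum, ← @inner_self_eq_norm_sq ℂ, he.inner_sum]
  simp [← sq, ← Complex.ofReal_pow]

/-- Here `U` has the conjugated Bell vectors as rows; its columns are orthonormal by
`pauliString_complete`. -/
theorem le_cbcEntropy_add_bbcEntropy {n : ℕ} {ψ : EuclideanSpace ℂ (Bits n × Bits n)}
    (hψ : ∑ x, ‖ψ x‖ ^ 2 = 1) {α β : ℝ≥0∞} (hαβ : 1 / α + 1 / β = 2) :
    (n : ℝ) ≤ cbcEntropy α ψ + bbcEntropy β ψ := by
  rw [← neg_two_logb_normFactor n]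
  refine neg_two_logb_le_renyiEntropy_add_of_isometry
    (fun (k : Fin n → Fin 4) x => (starRingEnd ℂ) (normFactor n * pauliString k x.1 x.2))
    (normFactor_pos n) (fun k x => ?_) (fun x y => ?_) (fun k => ?_) hψ hαβ
  · rw [Complex.norm_conj, norm_mul, Complex.norm_real, Real.norm_of_nonneg (normFactor_pos n).le]
    exact mul_le_of_le_one_right (normFactor_pos n).le (norm_pauliString_le_one _ _ _)
  · have h : ∀ k : Fin n → Fin 4,
        (starRingEnd ℂ) ((starRingEnd ℂ) (normFactor n * pauliString k x.1 x.2)) *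
          (starRingEnd ℂ) (normFactor n * pauliString k y.1 y.2) =
        (normFactor n * normFactor n) *
          ((starRingEnd ℂ) (pauliString k y.1 y.2) * pauliString k x.1 x.2) := by
      intro k
      rw [Complex.conj_conj, map_mul, Complex.conj_ofReal]
      ring
    simp only [h]
    rw [← Finset.mul_sum, pauliString_complete, normFactor_mul_self]
    simp only [Prod.mk.eta, eq_comm (a := y)]
    split_ifs <;> simp
  · simp [bellCoeff, bellVec, vectorize, PiLp.inner_apply, mul_comm]

theorem le_teEntropy_add_fteEntropy {n : ℕ} {γ : Bits n → ℝ}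
    (hγ : ∑ x, γ x ^ 2 = 1) {α β : ℝ≥0∞} (hαβ : 1 / α + 1 / β = 2) :
    (n : ℝ) ≤ teEntropy α γ + fteEntropy β γ := by
  set w : Bits n → ℝ := fun s =>
    normFactor n * ∑ x, (-1) ^ (∑ i, (s i : ℕ) * (x i : ℕ)) * γ x with hw
  have h := neg_two_logb_le_renyiEntropy_add_of_isometry
    (fun s x : Bits n => (normFactor n : ℂ) * (-1) ^ (∑ i, (s i : ℕ) * (x i : ℕ)))
    (a := fun x => (γ x : ℂ)) (b := fun s => (w s : ℂ))
    (normFactor_pos n) (fun s x => ?_) (fun x y => ?_) (fun s => ?_)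
    (by simpa using hγ) hαβ
  -- The transform yields the signed numbers `w s`; `walshCoeff` is their absolute value, so the
  -- squares agree.
  · rw [neg_two_logb_normFactor] at h
    simp only [Complex.norm_real, Real.norm_eq_abs, sq_abs] at h
    simpa only [teEntropy, fteEntropy, walshCoeff, sq_abs] using h
  · simp [abs_of_pos (normFactor_pos n)]
  · have h : ∀ s : Bits n,
        (starRingEnd ℂ) (normFactor n * (-1) ^ (∑ i, (s i : ℕ) * (x i : ℕ))) *
          (normFactor n * (-1) ^ (∑ i, (s i : ℕ) * (y i : ℕ))) =
        (normFactor n * normFactor n) * ((-1) ^ (∑ i, (s i : ℕ) * (x i : ℕ)) *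
          (-1) ^ (∑ i, (s i : ℕ) * (y i : ℕ))) := by
      intro s
      simp only [map_mul, map_pow, map_neg, map_one, Complex.conj_ofReal]
      ring
    simp only [h]
    rw [← Finset.mul_sum, sum_walshChar_mul_walshChar, normFactor_mul_self]
    split_ifs <;> simp
  · simp only [hw]
    push_cast
    rw [Finset.mul_sum]
    exact Finset.sum_congr rfl fun x _ => by ring

end OperatorEntropy

theorem theorem3 (n : ℕ) (O : OperatorEntropy.QubitOp n) (hO : ‖O‖ = 1)
    (α β : ℝ≥0∞) (hα : 1 / 2 ≤ α) (hβ : 1 / 2 ≤ β) (hαβ : 1 / α + 1 / β = 2) :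
    (n : ℝ) ≤ OperatorEntropy.cbcEntropy α (OperatorEntropy.vectorize O) +
        OperatorEntropy.bbcEntropy β (OperatorEntropy.vectorize O) ∧
      ∀ γ : OperatorEntropy.Bits n → ℝ,
        OperatorEntropy.IsTimeSchmidt (OperatorEntropy.vectorize O) γ →
          (n : ℝ) ≤ OperatorEntropy.teEntropy α γ + OperatorEntropy.fteEntropy β γ := by
  have hψ := OperatorEntropy.sum_norm_vectorize_sq hO
  exact ⟨OperatorEntropy.le_cbcEntropy_add_bbcEntropy hψ hαβ, fun γ hγ =>
    OperatorEntropy.le_teEntropy_add_fteEntropy (hγ.sum_sq.trans hψ) hαβ⟩
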